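/- \textbf{Setting.} Let $N\ge 1$, $K\ge 1$, $0\le M\le K$ be integers, let $\mathcal X$ be a finite alphabet with at least two symbols, and let $1\ge r_1\ge r_2\ge\dots\ge r_M\ge 0$ be real numbers; put $S=\sum_{i=1}^M r_i$. All entropies are taken to base $|\mathcal X|$. Each of $N$ non-colluding databases stores the same $K$ messages $W_1,\dots,W_K\in\mathcal X^L$, which are independent and uniformly distributed. The user has accessed $M$ distinct messages, described by an injection $\mathbb H:\{1,\dots,M\}\to\{1,\dots,K\}$, and has cached the first $\lfloor r_iL\rfloor$ symbols of $W_{\mathbb H(i)}$ for $i=1,\dots,M$ (a cache of size $SL$ up to rounding); call the cache contents $\mathcal W_{\mathbb H}$. A scheme of message length $L$ prescribes, for every $\theta\in\{1,\dots,K\}$ and every $\mathbb H$, a discrete joint law of queries $Q_1^{[\theta,\mathbb H]},\dots,Q_N^{[\theta,\mathbb H]}$, drawn independently of $(W_1,\dots,W_K)$, and for every $n$ an answering function, so that the answer $A_n^{[\theta,\mathbb H]}$ of database $n$ is a function of $Q_n^{[\theta,\mathbb H]}$ and $W_1,\dots,W_K$. The scheme is \emph{private} if for each $n$ the law of $(Q_n^{[\theta,\mathbb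 H]},A_n^{[\theta,\mathbb H]},W_1,\dots,W_K)$ does not depend on $(\theta,\mathbb H)$. Its download cost is $D=\sum_{n=1}^N H(A_n^{[\theta,\mathbb H]})$, which for a private scheme does not depend on $(\theta,\mathbb H)$. A number $d$ is an \emph{achievable normalized download cost} if there is a sequence of private schemes with message lengths $L\to\infty$ such that $D/L\to d$ and, for all $\theta$ and $\mathbb H$, $$H\bigl(W_\theta\,\big|\,\mathcal W_{\mathbb H},Q_1^{[\theta,\mathbb H]},\dots,Q_N^{[\theta,\mathbb H]},A_1^{[\theta,\mathbb H]},\dots,A_N^{[\theta,\mathbb H]}\bigr)=o(L).$$ The optimal normalized download cost $D^*$ is the infimum of all achievable normalized download costs. \textbf{Theorem.} $$D^*=1+\frac1N+\frac1{N^2}+\dots+\frac1{N^{K-1-M}}+\frac{1-r_M}{N^{K-M}}+\frac{1-r_{M-1}}{N^{K-M+1}}+\dots+\frac{1-r_1}{N^{K-1}},$$ that is, $D^*=\sum_{k=0}^{K-M-1}N^{-k}+\sum_{i=1}^{M}(1-r_i)\,N^{-(K-i)}$ (the first sum is empty if $M=K$). -/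

import Mathlib

open scoped ENNReal Topology

noncomputable section

namespace PIRPSI

/-- Shannon entropy `H(X)`, in units of `log b`, of the discrete random variable `X` on the
discrete probability space `(Ω, p)`.  Every summand is the `ofReal` of a nonnegative number. -/
def entropy {Ω α : Type*} (b : ℕ) (p : PMF Ω) (X : Ω → α) : ℝ≥0∞ :=
  ∑' x, ENNReal.ofReal (-((p.map X x).toReal * Real.logb b (p.map X x).toReal))

/-- Conditional Shannon entropy
`H(X | Y) = - ∑_{x, y} P(X = x, Y = y) log_b (P(X = x, Y = y) / P(Y = y))`. -/
def condEntropy {Ω α β : Type*} (b : ℕ) (p : PMF Ω) (X : Ω → α) (Y : Ω → β) : ℝ≥0∞ :=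
  ∑' z : α × β,
    ENNReal.ofReal (-((p.map (fun ω => (X ω, Y ω)) z).toReal *
      Real.logb b ((p.map (fun ω => (X ω, Y ω)) z).toReal / (p.map Y z.2).toReal)))

/-- The contents of a database: `K` messages of `L` symbols each, over the alphabet `𝒳`. -/
abbrev Messages (𝒳 : Type*) (K L : ℕ) : Type _ := Fin K → Fin L → 𝒳

/-- Which messages the user has accessed: `ℍ i` is the message of which the fraction `r i`
is cached. -/
abbrev CacheIndex (M K : ℕ) : Type := Fin M ↪ Fin K

/-- The cache contents `𝒲_ℍ`: the first `⌊r i * L⌋` symbols of message `ℍ i`, for every `i`. -/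
def cached {𝒳 : Type*} {K M L : ℕ} (r : Fin M → ℝ) (ℍ : CacheIndex M K) (w : Messages 𝒳 K L) :
    (i : Fin M) → {l : Fin L // (l : ℕ) < ⌊r i * L⌋₊} → 𝒳 :=
  fun i l => w (ℍ i) l.1

/-- A retrieval scheme with `N` databases, each storing the same `K` messages of length `L`, for
a user who has accessed `M` messages.  Given the desired index `θ` and the cache indices `ℍ`, the
user draws the `N` queries at random, without looking at the messages.  Database `n` answers with a
function of its own query and of all the messages. -/
structure Scheme (𝒳 : Type*) (N K M L : ℕ) where
  /-- the set of possible queries (a `PMF` on it is a discrete law; it need not be finite) -/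
  Query : Type
  /-- the set of possible answering strings -/
  Answer : Type
  /-- the joint law of the queries `Q₁, …, Q_N`, given `θ` and `ℍ` -/
  queryLaw : Fin K → CacheIndex M K → PMF (Fin N → Query)
  /-- the answering function of each database -/
  answer : Fin N → Query → Messages 𝒳 K L → Answer

namespace Scheme

variable {𝒳 : Type*} [Fintype 𝒳] [Nonempty 𝒳] {N K M L : ℕ} (𝒮 : Scheme 𝒳 N K M L)

/-- The joint law of all queries and all messages, given `θ` and `ℍ`: the messages consist of
`K * L` independent uniform symbols and are independent of the queries. -/
def jointLaw (θ : Fin K) (ℍ : CacheIndex M K) : PMF ((Fin N → 𝒮.Query) × Messages 𝒳 K L) :=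
  (𝒮.queryLaw θ ℍ).bind fun Q =>
    (PMF.uniformOfFintype (Messages 𝒳 K L)).map fun w => (Q, w)

/-- The answer `A_n` as a random variable. -/
def ans (n : Fin N) (ω : (Fin N → 𝒮.Query) × Messages 𝒳 K L) : 𝒮.Answer :=
  𝒮.answer n (ω.1 n) ω.2

/-- Privacy: what database `n` sees, that is `(Q_n, A_n, W_1, …, W_K)`, has the same law for all
desired indices and all cache indices. -/
def IsPrivate : Prop :=
  ∀ (n : Fin N) (θ θ' : Fin K) (ℍ ℍ' : CacheIndex M K),
    (𝒮.jointLaw θ ℍ).map (fun ω => (ω.1 n, 𝒮.ans n ω, ω.2)) =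
      (𝒮.jointLaw θ' ℍ').map (fun ω => (ω.1 n, 𝒮.ans n ω, ω.2))

/-- `H(W_θ | 𝒲_ℍ, Q_1, …, Q_N, A_1, …, A_N)`, given `θ` and `ℍ`, in symbols. -/
def equivocation (r : Fin M → ℝ) (θ : Fin K) (ℍ : CacheIndex M K) : ℝ≥0∞ :=
  condEntropy (Fintype.card 𝒳) (𝒮.jointLaw θ ℍ) (fun ω => ω.2 θ)
    (fun ω => (cached r ℍ ω.2, ω.1, fun n => 𝒮.ans n ω))

/-- The download cost `D = ∑ n, H(A_n)`, given `θ` and `ℍ`, in symbols. -/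
def download (θ : Fin K) (ℍ : CacheIndex M K) : ℝ≥0∞ :=
  ∑ n, entropy (Fintype.card 𝒳) (𝒮.jointLaw θ ℍ) (𝒮.ans n)

end Scheme

/-- `d` is an achievable normalized download cost for the caching scheme `r`: there are private
schemes, for message lengths `L → ∞`, with `H(W_θ | …) = o(L)` and `D / L → d`. -/
def IsAchievable (𝒳 : Type*) [Fintype 𝒳] [Nonempty 𝒳] (N K M : ℕ) (r : Fin M → ℝ)
    (d : ℝ≥0∞) : Prop :=
  ∃ (L : ℕ → ℕ) (𝒮 : (j : ℕ) → Scheme 𝒳 N K M (L j)),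
    Filter.Tendsto L Filter.atTop Filter.atTop ∧
    (∀ j, (𝒮 j).IsPrivate) ∧
    (∀ θ ℍ, Filter.Tendsto (fun j => (𝒮 j).equivocation r θ ℍ / (L j : ℝ≥0∞))
      Filter.atTop (𝓝 0)) ∧
    (∀ θ ℍ, Filter.Tendsto (fun j => (𝒮 j).download θ ℍ / (L j : ℝ≥0∞))
      Filter.atTop (𝓝 d))

/-- The optimal normalized download cost `D*` (`∞` if nothing were achievable). -/
def optimalCost (𝒳 : Type*) [Fintype 𝒳] [Nonempty 𝒳] (N K M : ℕ) (r : Fin M → ℝ) : ℝ≥0∞ :=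
  sInf {d | IsAchievable 𝒳 N K M r d}

end PIRPSI

end

/-!
For the converse, add the messages one at a time, the least cached first, to what the user knows.
By the chain rule for `H(W_θ, A_1, …, A_N | Q_1, …, Q_N, W_P)`, the answers conditioned on the known
symbols `W_P` have entropy at least the number of symbols of `W_θ` outside `P` plus the entropy of
the answers conditioned on `W_P` and `W_θ`. The latter is at least the average over the databases of
the entropies of the single answers. As each of these is the same for all `θ` by privacy, this
recursion applies again with the next message as the desired one, at the price of a factor `1 / N`.

For achievability, start from a retrieval code without side information in which anyone who knows
`m` messages can compute a certain number of symbols of each answer, depending only on `m`. Let the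
databases return the answers compressed by a Reed–Solomon code to as many syndromes as the number
of remaining symbols: these complete what any user with `m` messages knows, and the databases need
not learn which messages these are. The messages are cut into short blocks, so that each block of
each message is either cached entirely or treated as unknown, and this is applied block by block.
-/

namespace PIRPSI

noncomputable section

section Entropy

variable {Ω α β γ ι : Type*} {b : ℕ} {p : PMF Ω}

lemma tsum_map_mul (p : PMF Ω) (f : Ω → α) (g : α → ℝ≥0∞) :
    ∑' a, p.map f a * g a = ∑' ω, p ω * g (f ω) := by
  classical
  simp_rw [PMF.map_apply, ← ENNReal.tsum_mul_right]
  rw [ENNReal.tsum_comm]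
  refine tsum_congr fun ω => ?_
  rw [tsum_eq_single (f ω) fun a ha => by simp [ha]]
  simp

lemma map_apply_le {f : Ω → α} {g : Ω → β} {x : α} {y : β} (h : ∀ ω, x = f ω → y = g ω) :
    p.map f x ≤ p.map g y := by
  classical
  simp only [PMF.map_apply]
  refine ENNReal.tsum_le_tsum fun ω => ?_
  by_cases hx : x = f ω
  · simp only [hx, h ω hx, if_true, le_refl]
  · simp only [hx, if_false, zero_le]

lemma map_apply_congr {f : Ω → α} {g : Ω → β} {x : α} {y : β} (h : ∀ ω, x = f ω ↔ y = g ω) :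
    p.map f x = p.map g y :=
  (map_apply_le fun ω => (h ω).1).antisymm (map_apply_le fun ω => (h ω).2)

lemma map_apply_ne_zero {ω : Ω} (hω : ω ∈ p.support) (f : Ω → α) : p.map f (f ω) ≠ 0 :=
  (PMF.mem_support_iff _ _).1 ((PMF.mem_support_map_iff _ _ _).2 ⟨ω, hω, rfl⟩)

lemma tsum_map_prodMk (p : PMF Ω) (X : Ω → α) (Y : Ω → β) (y : β) :
    ∑' x, p.map (fun ω => (X ω, Y ω)) (x, y) = p.map Y y := by
  classical
  simp only [PMF.map_apply, Prod.mk.injEq, ite_and]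
  rw [ENNReal.tsum_comm]
  exact tsum_congr fun ω => tsum_ite_eq (X ω) _

/-- The information content `-log_b x`, in units of `log b`, of an event of probability `x ≤ 1`.
It is an extended nonnegative real so that expectations of surprisals need no summability. -/
def surprisal (b : ℕ) (x : ℝ≥0∞) : ℝ≥0∞ := ENNReal.ofReal (-Real.logb b x.toReal)

lemma surprisal_le_surprisal {x y : ℝ≥0∞} (hx : x ≠ 0) (hxy : x ≤ y) (hy : y ≤ 1) :
    surprisal b y ≤ surprisal b x := by
  have hyt : y ≠ ∞ := ne_top_of_le_ne_top ENNReal.one_ne_top hy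
  have hx0 : 0 < x.toReal := ENNReal.toReal_pos hx (ne_top_of_le_ne_top hyt hxy)
  have : 0 ≤ Real.log b := Real.log_natCast_nonneg b
  unfold surprisal Real.logb
  gcongr

lemma neg_logb_toReal_nonneg {x : ℝ≥0∞} (hx : x ≤ 1) : 0 ≤ -Real.logb b x.toReal := by
  rw [Real.logb, ← neg_div]
  exact div_nonneg (neg_nonneg.2 (Real.log_nonpos ENNReal.toReal_nonneg
    (ENNReal.toReal_le_of_le_ofReal zero_le_one (by simpa using hx)))) (Real.log_natCast_nonneg b)

lemma surprisal_mul {x y : ℝ≥0∞} (hx : x ≠ 0) (hx1 : x ≤ 1) (hy : y ≠ 0) (hy1 : y ≤ 1) :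
    surprisal b (x * y) = surprisal b x + surprisal b y := by
  have htoReal : ∀ {z : ℝ≥0∞}, z ≠ 0 → z ≤ 1 → z.toReal ≠ 0 := fun h0 h1 =>
    ENNReal.toReal_ne_zero.2 ⟨h0, ne_top_of_le_ne_top ENNReal.one_ne_top h1⟩
  rw [surprisal, ENNReal.toReal_mul, Real.logb_mul (htoReal hx hx1) (htoReal hy hy1), neg_add,
    ENNReal.ofReal_add (neg_logb_toReal_nonneg hx1) (neg_logb_toReal_nonneg hy1), surprisal,
    surprisal]

lemma surprisal_add_le {x y : ℝ≥0∞} (hx : x ≠ 0) (hx1 : x ≤ 1) (hy : y ≠ 0) (hy1 : y ≤ 1) :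
    surprisal b x + ENNReal.ofReal (Real.log b)⁻¹ ≤
      surprisal b y + ENNReal.ofReal (Real.log b)⁻¹ * (y / x) := by
  have hxt : x ≠ ∞ := ne_top_of_le_ne_top ENNReal.one_ne_top hx1
  have hyt : y ≠ ∞ := ne_top_of_le_ne_top ENNReal.one_ne_top hy1
  have hx0 : 0 < x.toReal := ENNReal.toReal_pos hx hxt
  have hy0 : 0 < y.toReal := ENNReal.toReal_pos hy hyt
  have hb : 0 ≤ (Real.log b)⁻¹ := inv_nonneg.2 (Real.log_natCast_nonneg b)
  have htangent : Real.log y.toReal - Real.log x.toReal ≤ y.toReal / x.toReal - 1 := by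
    rw [← Real.log_div hy0.ne' hx0.ne']
    exact Real.log_le_sub_one_of_pos (div_pos hy0 hx0)
  have hdiv : y / x = ENNReal.ofReal (y.toReal / x.toReal) := by
    rw [← ENNReal.toReal_div, ENNReal.ofReal_toReal (ENNReal.div_ne_top hyt hx)]
  rw [hdiv, surprisal, surprisal, ← ENNReal.ofReal_mul hb,
    ← ENNReal.ofReal_add (neg_logb_toReal_nonneg hx1) hb,
    ← ENNReal.ofReal_add (neg_logb_toReal_nonneg hy1) (by positivity)]
  refine ENNReal.ofReal_le_ofReal ?_
  have := mul_le_mul_of_nonneg_left htangent hb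
  simp only [Real.logb, div_eq_mul_inv] at this ⊢
  linarith

/-- The conditional probability `P(X = x | Y = y)`, which is `0` if `P(Y = y) = 0`. -/
def condProb (p : PMF Ω) (X : Ω → α) (Y : Ω → β) (x : α) (y : β) : ℝ≥0∞ :=
  p.map (fun ω => (X ω, Y ω)) (x, y) / p.map Y y

lemma condProb_le_one (p : PMF Ω) (X : Ω → α) (Y : Ω → β) (x : α) (y : β) :
    condProb p X Y x y ≤ 1 :=
  ENNReal.div_le_of_le_mul (by rw [one_mul]; exact map_apply_le fun ω h => congrArg Prod.snd h)

lemma condProb_ne_zero {ω : Ω} (hω : ω ∈ p.support) (X : Ω → α) (Y : Ω → β) :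
    condProb p X Y (X ω) (Y ω) ≠ 0 :=
  ENNReal.div_ne_zero.2 ⟨map_apply_ne_zero hω fun ω => (X ω, Y ω), PMF.apply_ne_top _ _⟩

lemma tsum_condProb_le_one (p : PMF Ω) (X : Ω → α) (Y : Ω → β) (y : β) :
    ∑' x, condProb p X Y x y ≤ 1 := by
  simp only [condProb, div_eq_mul_inv]
  rw [ENNReal.tsum_mul_right, tsum_map_prodMk]
  exact ENNReal.div_self_le_one

lemma condProb_prodMk {ω : Ω} (hω : ω ∈ p.support) (X : Ω → α) (Y : Ω → β) (Z : Ω → γ) :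
    condProb p (fun ω => (X ω, Y ω)) Z (X ω, Y ω) (Z ω) =
      condProb p X Z (X ω) (Z ω) * condProb p Y (fun ω => (X ω, Z ω)) (Y ω) (X ω, Z ω) := by
  have hXZ : p.map (fun ω => (X ω, Z ω)) (X ω, Z ω) ≠ 0 :=
    map_apply_ne_zero hω fun ω => (X ω, Z ω)
  have hassoc : p.map (fun ω => ((X ω, Y ω), Z ω)) ((X ω, Y ω), Z ω) =
      p.map (fun ω => (Y ω, X ω, Z ω)) (Y ω, X ω, Z ω) :=
    map_apply_congr fun ω' => by simp only [Prod.mk.injEq]; tauto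
  rw [condProb, condProb, condProb, hassoc, mul_comm, ← mul_div_assoc,
    ENNReal.div_mul_cancel hXZ (PMF.apply_ne_top _ _)]

lemma condEntropy_eq_tsum (b : ℕ) (p : PMF Ω) (X : Ω → α) (Y : Ω → β) :
    condEntropy b p X Y = ∑' ω, p ω * surprisal b (condProb p X Y (X ω) (Y ω)) := by
  rw [condEntropy, ← tsum_map_mul p (fun ω => (X ω, Y ω)) fun z =>
    surprisal b (condProb p X Y z.1 z.2)]
  refine tsum_congr fun z => ?_
  rw [← mul_neg, ENNReal.ofReal_mul ENNReal.toReal_nonneg,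
    ENNReal.ofReal_toReal (PMF.apply_ne_top _ _), surprisal, condProb, ENNReal.toReal_div]

lemma condEntropy_const (b : ℕ) (p : PMF Ω) (X : Ω → α) (c : β) :
    condEntropy b p X (fun _ => c) = entropy b p X := by
  have hcond : ∀ x, condProb p X (fun _ => c) x c = p.map X x := fun x => by
    rw [condProb, show p.map (fun ω => (X ω, c)) (x, c) = p.map X x from
      map_apply_congr fun ω => by simp, show p.map (fun _ => c) = PMF.pure c from p.map_const c,
      PMF.pure_apply_self, div_one]
  simp only [condEntropy_eq_tsum, hcond]
  rw [entropy, ← tsum_map_mul p X fun x => surprisal b (p.map X x)]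
  refine tsum_congr fun x => ?_
  rw [← mul_neg, ENNReal.ofReal_mul ENNReal.toReal_nonneg,
    ENNReal.ofReal_toReal (PMF.apply_ne_top _ _), surprisal]

lemma condEntropy_le_tsum_surprisal (b : ℕ) {X : Ω → α} {Y : Ω → β} {q : α → β → ℝ≥0∞}
    (hq : ∀ y, ∑' x, q x y ≤ 1) (hq0 : ∀ ω ∈ p.support, q (X ω) (Y ω) ≠ 0) :
    condEntropy b p X Y ≤ ∑' ω, p ω * surprisal b (q (X ω) (Y ω)) := by
  set c := ENNReal.ofReal (Real.log b)⁻¹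
  set u : Ω → ℝ≥0∞ := fun ω => condProb p X Y (X ω) (Y ω) with hu
  have hratio : ∑' ω, p ω * (q (X ω) (Y ω) / u ω) ≤ 1 := by
    rw [← tsum_map_mul p (fun ω => (X ω, Y ω)) fun z => q z.1 z.2 / condProb p X Y z.1 z.2]
    calc
      _ ≤ ∑' z : α × β, q z.1 z.2 * p.map Y z.2 := ENNReal.tsum_le_tsum fun z => by
        by_cases hz : p.map (fun ω => (X ω, Y ω)) z = 0
        · simp [hz]
        · rw [condProb, ENNReal.div_eq_inv_mul, ENNReal.inv_div (.inl (PMF.apply_ne_top _ _))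
            (.inr hz), ← mul_assoc, ENNReal.mul_div_cancel hz
            (PMF.apply_ne_top _ _), mul_comm]
      _ = ∑' y, (∑' x, q x y) * p.map Y y := by
        rw [ENNReal.tsum_prod', ENNReal.tsum_comm]
        simp only [ENNReal.tsum_mul_right]
      _ ≤ ∑' y, 1 * p.map Y y := ENNReal.tsum_le_tsum fun y => by gcongr; exact hq y
      _ = 1 := by simp only [one_mul, PMF.tsum_coe]
  rw [← ENNReal.add_le_add_iff_right (a := c) ENNReal.ofReal_ne_top, condEntropy_eq_tsum]
  calc
    _ = ∑' ω, p ω * (surprisal b (u ω) + c) := by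
      simp only [mul_add, ENNReal.tsum_add, ENNReal.tsum_mul_right, PMF.tsum_coe, one_mul, hu]
    _ ≤ ∑' ω, p ω * (surprisal b (q (X ω) (Y ω)) + c * (q (X ω) (Y ω) / u ω)) :=
      ENNReal.tsum_le_tsum fun ω => by
        by_cases hω : p ω = 0
        · simp [hω]
        have hω : ω ∈ p.support := (PMF.mem_support_iff _ _).2 hω
        have hq1 : q (X ω) (Y ω) ≤ 1 := (ENNReal.le_tsum (f := (q · (Y ω))) (X ω)).trans (hq _)
        exact mul_le_mul_right
          (surprisal_add_le (condProb_ne_zero hω X Y) (condProb_le_one ..) (hq0 ω hω) hq1) _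
    _ = ∑' ω, p ω * surprisal b (q (X ω) (Y ω)) + c * ∑' ω, p ω * (q (X ω) (Y ω) / u ω) := by
      simp only [mul_add, ENNReal.tsum_add, ← ENNReal.tsum_mul_left, mul_left_comm c]
    _ ≤ _ := by gcongr; exact mul_le_of_le_one_right' hratio

lemma condEntropy_le_of_factorsThrough_right (b : ℕ) (p : PMF Ω) (X : Ω → α) {Y : Ω → β}
    {Z : Ω → γ} (h : Z.FactorsThrough Y) : condEntropy b p X Y ≤ condEntropy b p X Z := by
  obtain ⟨ω₀, -⟩ := p.support_nonempty
  have : Nonempty γ := ⟨Z ω₀⟩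
  obtain ⟨g, rfl⟩ := (Function.factorsThrough_iff Z).1 h
  rw [condEntropy_eq_tsum b p X (g ∘ Y)]
  exact condEntropy_le_tsum_surprisal b (q := fun x y => condProb p X (g ∘ Y) x (g y))
    (fun y => tsum_condProb_le_one ..) fun ω hω => condProb_ne_zero hω X (g ∘ Y)

lemma condEntropy_le_of_factorsThrough_left (b : ℕ) (p : PMF Ω) {X : Ω → α} {X' : Ω → β}
    (Y : Ω → γ) (h : X'.FactorsThrough X) : condEntropy b p X' Y ≤ condEntropy b p X Y := by
  rw [condEntropy_eq_tsum, condEntropy_eq_tsum]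
  refine ENNReal.tsum_le_tsum fun ω => ?_
  by_cases hω : p ω = 0
  · simp [hω]
  gcongr
  refine surprisal_le_surprisal (condProb_ne_zero ((PMF.mem_support_iff _ _).2 hω) X Y) ?_
    (condProb_le_one ..)
  unfold condProb
  gcongr
  exact map_apply_le fun ω' hω' =>
    Prod.ext (h (Prod.mk.inj hω').1) (Prod.mk.inj hω').2

lemma condEntropy_le_entropy (b : ℕ) (p : PMF Ω) (X : Ω → α) (Y : Ω → β) :
    condEntropy b p X Y ≤ entropy b p X :=
  (condEntropy_le_of_factorsThrough_right b p X fun _ _ _ => rfl).trans_eq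
    (condEntropy_const b p X ())

lemma condEntropy_prodMk (b : ℕ) (p : PMF Ω) (X : Ω → α) (Y : Ω → β) (Z : Ω → γ) :
    condEntropy b p (fun ω => (X ω, Y ω)) Z =
      condEntropy b p X Z + condEntropy b p Y (fun ω => (X ω, Z ω)) := by
  simp only [condEntropy_eq_tsum, ← ENNReal.tsum_add, ← mul_add]
  refine tsum_congr fun ω => ?_
  by_cases hω : p ω = 0
  · simp [hω]
  have hω : ω ∈ p.support := (PMF.mem_support_iff _ _).2 hω
  rw [condProb_prodMk hω, surprisal_mul (condProb_ne_zero hω X Z) (condProb_le_one ..)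
    (condProb_ne_zero hω Y fun ω => (X ω, Z ω)) (condProb_le_one ..)]

lemma condEntropy_add_condEntropy_comm (b : ℕ) (p : PMF Ω) (X : Ω → α) (Y : Ω → β) (Z : Ω → γ) :
    condEntropy b p X Z + condEntropy b p Y (fun ω => (X ω, Z ω)) =
      condEntropy b p Y Z + condEntropy b p X (fun ω => (Y ω, Z ω)) := by
  rw [← condEntropy_prodMk, ← condEntropy_prodMk]
  refine le_antisymm ?_ ?_ <;>
    exact condEntropy_le_of_factorsThrough_left b p Z fun ω ω' h => congrArg Prod.swap h

lemma condEntropy_eq_zero (b : ℕ) {X : Ω → α} {Y : Ω → β}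
    (h : ∀ ω ∈ p.support, ∀ ω' ∈ p.support, Y ω = Y ω' → X ω = X ω') :
    condEntropy b p X Y = 0 := by
  classical
  rw [condEntropy_eq_tsum, ENNReal.tsum_eq_zero]
  intro ω
  by_cases hω : p ω = 0
  · simp [hω]
  have hω : ω ∈ p.support := (PMF.mem_support_iff _ _).2 hω
  have heq : p.map (fun ω => (X ω, Y ω)) (X ω, Y ω) = p.map Y (Y ω) := by
    simp only [PMF.map_apply, Prod.mk.injEq]
    refine tsum_congr fun ω' => ?_
    by_cases hω' : p ω' = 0
    · simp [hω']
    · exact if_congr (and_iff_right_of_imp (h ω hω ω' ((PMF.mem_support_iff _ _).2 hω'))) rfl rfl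
  rw [condProb, heq, ENNReal.div_self (map_apply_ne_zero hω Y) (PMF.apply_ne_top _ _)]
  simp [surprisal]

lemma condEntropy_pi_le (b : ℕ) (p : PMF Ω) {N : ℕ} (A : Fin N → Ω → α) (Y : Ω → β) :
    condEntropy b p (fun ω n => A n ω) Y ≤ ∑ n, condEntropy b p (A n) Y := by
  induction N with
  | zero => exact (condEntropy_eq_zero b fun _ _ _ _ _ => Subsingleton.elim _ _).trans_le zero_le
  | succ N ih =>
    rw [Fin.sum_univ_succ]
    calc
      _ ≤ condEntropy b p (fun ω => (A 0 ω, fun n : Fin N => A n.succ ω)) Y :=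
        condEntropy_le_of_factorsThrough_left b p Y fun ω ω' h => funext <|
          Fin.cases (congrArg Prod.fst h) fun n => congrFun (congrArg Prod.snd h) n
      _ = condEntropy b p (A 0) Y +
          condEntropy b p (fun ω (n : Fin N) => A n.succ ω) (fun ω => (A 0 ω, Y ω)) :=
        condEntropy_prodMk ..
      _ ≤ condEntropy b p (A 0) Y + condEntropy b p (fun ω (n : Fin N) => A n.succ ω) Y := by
        gcongr
        exact condEntropy_le_of_factorsThrough_right b p _ fun _ _ h => congrArg Prod.snd h
      _ ≤ _ := by gcongr; exact ih fun n => A n.succ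

lemma entropy_le_logb_card (b : ℕ) [Fintype α] (p : PMF Ω) (X : Ω → α) :
    entropy b p X ≤ ENNReal.ofReal (Real.logb b (Fintype.card α)) := by
  obtain ⟨ω₀, -⟩ := p.support_nonempty
  have : Nonempty α := ⟨X ω₀⟩
  rw [← condEntropy_const b p X ()]
  calc
    _ ≤ ∑' ω, p ω * surprisal b (Fintype.card α : ℝ≥0∞)⁻¹ :=
      condEntropy_le_tsum_surprisal b (q := fun _ _ => (Fintype.card α : ℝ≥0∞)⁻¹)
        (fun _ => by simp [ENNReal.mul_inv_cancel]) (by simp)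
    _ = _ := by
      rw [ENNReal.tsum_mul_right, PMF.tsum_coe, one_mul]
      simp [surprisal, Real.logb_inv]

lemma bind_map_mk_map_apply (p : PMF ι) (f : ι → PMF Ω) (Y : ι × Ω → β) (i : ι) (y : β) :
    (p.bind fun j => (f j).map (Prod.mk j)).map (fun z => (z.1, Y z)) (i, y) =
      p i * (f i).map (fun ω => Y (i, ω)) y := by
  classical
  simp only [PMF.map_bind, PMF.map_comp, PMF.bind_apply, Function.comp_def]
  rw [tsum_eq_single i fun j hj => by simp [PMF.map_apply, hj.symm]]
  exact congrArg (p i * ·) (map_apply_congr fun ω => by simp)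

lemma condEntropy_bind_map_mk (b : ℕ) (p : PMF ι) (f : ι → PMF Ω) (X : ι × Ω → α)
    (Y : ι × Ω → β) :
    condEntropy b (p.bind fun i => (f i).map (Prod.mk i)) X (fun z => (z.1, Y z)) =
      ∑' i, p i * condEntropy b (f i) (fun ω => X (i, ω)) (fun ω => Y (i, ω)) := by
  set μ := p.bind fun i => (f i).map (Prod.mk i)
  have happly : ∀ i ω, μ (i, ω) = p i * f i ω := fun i ω => by
    calc
      μ (i, ω) = μ.map id (i, ω) := by rw [PMF.map_id]
      _ = p i * (f i).map id ω := bind_map_mk_map_apply p f Prod.snd i ω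
      _ = p i * f i ω := by rw [PMF.map_id]
  have hcond : ∀ i ω, p i ≠ 0 → condProb μ X (fun z => (z.1, Y z)) (X (i, ω)) (i, Y (i, ω)) =
      condProb (f i) (fun ω => X (i, ω)) (fun ω => Y (i, ω)) (X (i, ω)) (Y (i, ω)) := by
    intro i ω hi
    have hswap : μ.map (fun z => (X z, z.1, Y z)) (X (i, ω), i, Y (i, ω)) =
        μ.map (fun z => (z.1, X z, Y z)) (i, X (i, ω), Y (i, ω)) :=
      map_apply_congr fun z => by simp only [Prod.mk.injEq]; tauto
    rw [condProb, condProb, hswap, bind_map_mk_map_apply p f fun z => (X z, Y z),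
      bind_map_mk_map_apply, ENNReal.mul_div_mul_left _ _ hi (PMF.apply_ne_top _ _)]
  simp only [condEntropy_eq_tsum, ENNReal.tsum_prod', happly, mul_assoc, ENNReal.tsum_mul_left]
  refine tsum_congr fun i => ?_
  by_cases hi : p i = 0
  · simp [hi]
  · simp only [hcond i _ hi]

end Entropy

section Converse

variable {𝒳 : Type*} {N K M L : ℕ}

lemma card_filter_forall_mem_eq {ι α : Type*} [Fintype ι] [DecidableEq ι] [Fintype α]
    [DecidableEq α] (P : Finset ι) (y : ι → α) :
    (Finset.univ.filter fun x : ι → α => ∀ i ∈ P, x i = y i).card = Fintype.card α ^ Pᶜ.card := by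
  have hpi : (Finset.univ.filter fun x : ι → α => ∀ i ∈ P, x i = y i) =
      Fintype.piFinset fun i => if i ∈ P then {y i} else Finset.univ := by
    ext x
    simp only [Finset.mem_filter, Finset.mem_univ, true_and, Fintype.mem_piFinset]
    refine forall_congr' fun i => ?_
    by_cases hi : i ∈ P <;> simp [hi]
  have hcard : ∀ i, (if i ∈ P then {y i} else Finset.univ : Finset α).card =
      if i ∈ Pᶜ then Fintype.card α else 1 := fun i => by
    by_cases hi : i ∈ P <;> simp [hi]
  rw [hpi, Fintype.card_piFinset, Finset.prod_congr rfl fun i _ => hcard i, Finset.prod_ite_mem,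
    Finset.univ_inter, Finset.prod_const]

/-- The symbols `W_P` of the messages at the positions in `P`; the position `(k, l)` is that of the
`l`-th symbol of message `k`. -/
def symbolsAt (P : Finset (Fin K × Fin L)) (w : Messages 𝒳 K L) : P → 𝒳 := fun p => w p.1.1 p.1.2

lemma symbolsAt_eq_iff {P : Finset (Fin K × Fin L)} {w w' : Messages 𝒳 K L} :
    symbolsAt P w = symbolsAt P w' ↔ ∀ p ∈ P, w p.1 p.2 = w' p.1 p.2 := by
  simp only [symbolsAt, funext_iff, Subtype.forall]

/-- The positions of the symbols in the cache, so that the cache contents are the symbols at these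
positions. -/
def cachedPositions (L : ℕ) (r : Fin M → ℝ) (ℍ : CacheIndex M K) : Finset (Fin K × Fin L) :=
  Finset.univ.filter fun p => ∃ i, ℍ i = p.1 ∧ (p.2 : ℕ) < ⌊r i * L⌋₊

lemma mem_cachedPositions {r : Fin M → ℝ} {ℍ : CacheIndex M K} {p : Fin K × Fin L} :
    p ∈ cachedPositions L r ℍ ↔ ∃ i, ℍ i = p.1 ∧ (p.2 : ℕ) < ⌊r i * L⌋₊ := by
  simp only [cachedPositions, Finset.mem_filter, Finset.mem_univ, true_and]

/-- The positions of the symbols of message `θ`. -/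
def messagePositions (L : ℕ) (θ : Fin K) : Finset (Fin K × Fin L) := {θ} ×ˢ Finset.univ

lemma mem_messagePositions {θ : Fin K} {p : Fin K × Fin L} :
    p ∈ messagePositions L θ ↔ p.1 = θ := by
  simp only [messagePositions, Finset.mem_product, Finset.mem_singleton, Finset.mem_univ, and_true]

lemma card_messagePositions (L : ℕ) (θ : Fin K) : (messagePositions L θ).card = L := by
  simp only [messagePositions, Finset.card_product, Finset.card_singleton, Finset.card_univ,
    Fintype.card_fin, one_mul]

lemma symbolsAt_union_messagePositions_eq_iff {P : Finset (Fin K × Fin L)} {θ : Fin K}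
    {w w' : Messages 𝒳 K L} :
    symbolsAt (P ∪ messagePositions L θ) w = symbolsAt (P ∪ messagePositions L θ) w' ↔
      w θ = w' θ ∧ symbolsAt P w = symbolsAt P w' := by
  have hmessage : (∀ p ∈ messagePositions L θ, w p.1 p.2 = w' p.1 p.2) ↔ w θ = w' θ := by
    simp only [mem_messagePositions, funext_iff]
    refine ⟨fun h l => h (θ, l) rfl, ?_⟩
    rintro h ⟨_, l⟩ rfl
    exact h l
  rw [symbolsAt_eq_iff, symbolsAt_eq_iff, ← hmessage, and_comm]
  simp only [Finset.mem_union, or_imp, forall_and]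

lemma surprisal_inv_natCast_pow {q : ℕ} (hq : 1 < q) (n : ℕ) :
    surprisal q ((q : ℝ≥0∞) ^ n)⁻¹ = n := by
  have hlog : Real.logb q q = 1 := Real.logb_self_eq_one (by exact_mod_cast hq)
  simp [surprisal, Real.logb_pow, hlog]

section Fintype

variable [Fintype 𝒳]

lemma uniformOfFintype_map_symbolsAt [Nonempty 𝒳] (P : Finset (Fin K × Fin L))
    (w : Messages 𝒳 K L) :
    (PMF.uniformOfFintype (Messages 𝒳 K L)).map (symbolsAt P) (symbolsAt P w) =
      ((Fintype.card 𝒳 : ℝ≥0∞) ^ P.card)⁻¹ := by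
  classical
  have hfiber : (Finset.univ.filter fun w' : Messages 𝒳 K L => symbolsAt P w = symbolsAt P w').card
      = Fintype.card 𝒳 ^ Pᶜ.card := by
    rw [← card_filter_forall_mem_eq P (Function.uncurry w)]
    refine Finset.card_equiv (Equiv.curry _ _ _).symm fun w' => ?_
    simp only [Finset.mem_filter, Finset.mem_univ, true_and, symbolsAt_eq_iff]
    exact forall₂_congr fun p _ => eq_comm
  have hcard : Fintype.card (Messages 𝒳 K L) =
      Fintype.card 𝒳 ^ Pᶜ.card * Fintype.card 𝒳 ^ P.card := by
    rw [← pow_add, add_comm, Finset.card_add_card_compl]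
    simp [← pow_mul, mul_comm]
  rw [PMF.map_apply, tsum_fintype]
  simp only [PMF.uniformOfFintype_apply]
  rw [← Finset.sum_filter, Finset.sum_const, nsmul_eq_mul, hfiber, hcard]
  push_cast
  rw [ENNReal.mul_inv (by simp) (by simp), ← mul_assoc,
    ENNReal.mul_inv_cancel (by simp) (by simp), one_mul]

lemma condEntropy_uniformOfFintype_symbolsAt [Nontrivial 𝒳] (P : Finset (Fin K × Fin L))
    (θ : Fin K) :
    condEntropy (Fintype.card 𝒳) (PMF.uniformOfFintype (Messages 𝒳 K L)) (fun w => w θ)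
      (symbolsAt P) = (messagePositions L θ \ P).card := by
  set q := Fintype.card 𝒳
  have hcond : ∀ w : Messages 𝒳 K L,
      condProb (PMF.uniformOfFintype (Messages 𝒳 K L)) (fun w => w θ) (symbolsAt P) (w θ)
        (symbolsAt P w) = ((q : ℝ≥0∞) ^ (messagePositions L θ \ P).card)⁻¹ := fun w => by
    have hq : (q : ℝ≥0∞) ^ P.card ≠ 0 := by simp [q]
    have hjoint : (PMF.uniformOfFintype (Messages 𝒳 K L)).map (fun w => (w θ, symbolsAt P w))
        (w θ, symbolsAt P w) = ((q : ℝ≥0∞) ^ (P ∪ messagePositions L θ).card)⁻¹ := by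
      rw [← uniformOfFintype_map_symbolsAt _ w]
      exact map_apply_congr fun w' => by
        rw [symbolsAt_union_messagePositions_eq_iff, Prod.mk.injEq]
    rw [condProb, hjoint, uniformOfFintype_map_symbolsAt, Finset.union_comm,
      ← Finset.sdiff_union_self_eq_union, Finset.card_union_of_disjoint Finset.sdiff_disjoint,
      pow_add, ENNReal.mul_inv (by simp [q]) (by simp [q]), div_eq_mul_inv, inv_inv, mul_assoc,
      ENNReal.inv_mul_cancel hq (by simp), mul_one]
  simp only [condEntropy_eq_tsum, hcond, ENNReal.tsum_mul_right, PMF.tsum_coe, one_mul]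
  exact surprisal_inv_natCast_pow Fintype.one_lt_card _

namespace Scheme

section Nonempty

variable [Nonempty 𝒳] (𝒮 : Scheme 𝒳 N K M L)

lemma isPrivate_iff : 𝒮.IsPrivate ↔ ∀ (n : Fin N) (θ θ' : Fin K) (ℍ ℍ' : CacheIndex M K),
    (𝒮.queryLaw θ ℍ).map (fun Q => Q n) = (𝒮.queryLaw θ' ℍ').map fun Q => Q n := by
  have hview : ∀ n θ ℍ, (𝒮.jointLaw θ ℍ).map (fun ω => (ω.1 n, 𝒮.ans n ω, ω.2)) =
      ((𝒮.queryLaw θ ℍ).map fun Q => Q n).bind fun a =>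
        (PMF.uniformOfFintype (Messages 𝒳 K L)).map fun w => (a, 𝒮.answer n a w, w) := by
    intro n θ ℍ
    rw [jointLaw, PMF.map_bind, PMF.bind_map]
    simp only [PMF.map_comp, Function.comp_def, ans]
  have hquery : ∀ n θ ℍ, ((𝒮.jointLaw θ ℍ).map fun ω => (ω.1 n, 𝒮.ans n ω, ω.2)).map Prod.fst =
      (𝒮.queryLaw θ ℍ).map fun Q => Q n := by
    intro n θ ℍ
    rw [PMF.map_comp, jointLaw, PMF.map_bind]
    simp only [PMF.map_comp, Function.comp_def]
    exact congrArg _ (funext fun Q => PMF.map_const _ _)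
  refine ⟨fun h n θ θ' ℍ ℍ' => ?_, fun h n θ θ' ℍ ℍ' => ?_⟩
  · rw [← hquery, h n θ θ' ℍ ℍ', hquery]
  · rw [hview, h n θ θ' ℍ ℍ', hview]

variable {𝒮} in
lemma IsPrivate.download_congr (h𝒮 : 𝒮.IsPrivate) (θ θ' : Fin K) (ℍ ℍ' : CacheIndex M K) :
    𝒮.download θ ℍ = 𝒮.download θ' ℍ' := by
  refine Finset.sum_congr rfl fun n _ => ?_
  have hans := congrArg (PMF.map fun v => v.2.1) (h𝒮 n θ θ' ℍ ℍ')
  simp only [PMF.map_comp, Function.comp_def] at hans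
  simp only [entropy, hans]

lemma condEntropy_jointLaw {α β : Type*} (b : ℕ) (θ : Fin K) (ℍ : CacheIndex M K)
    (X : (Fin N → 𝒮.Query) × Messages 𝒳 K L → α) (Y : Messages 𝒳 K L → β) :
    condEntropy b (𝒮.jointLaw θ ℍ) X (fun ω => (ω.1, Y ω.2)) = ∑' Q, 𝒮.queryLaw θ ℍ Q *
      condEntropy b (PMF.uniformOfFintype (Messages 𝒳 K L)) (fun w => X (Q, w)) Y :=
  condEntropy_bind_map_mk b (𝒮.queryLaw θ ℍ) (fun _ => PMF.uniformOfFintype _) X fun ω => Y ω.2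

/-- The conditional download cost `∑ n, H(A_n | Q_1, …, Q_N, W_P)` of a user who knows the symbols
at the positions in `P`. -/
def condDownload (θ : Fin K) (ℍ : CacheIndex M K) (P : Finset (Fin K × Fin L)) : ℝ≥0∞ :=
  ∑ n, condEntropy (Fintype.card 𝒳) (𝒮.jointLaw θ ℍ) (𝒮.ans n) fun ω => (ω.1, symbolsAt P ω.2)

variable {𝒮} in
lemma IsPrivate.condDownload_congr (h𝒮 : 𝒮.IsPrivate) (θ θ' : Fin K) (ℍ ℍ' : CacheIndex M K)
    (P : Finset (Fin K × Fin L)) : 𝒮.condDownload θ ℍ P = 𝒮.condDownload θ' ℍ' P := by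
  have hmarginal : ∀ n θ ℍ, condEntropy (Fintype.card 𝒳) (𝒮.jointLaw θ ℍ) (𝒮.ans n)
      (fun ω => (ω.1, symbolsAt P ω.2)) = ∑' a, (𝒮.queryLaw θ ℍ).map (fun Q => Q n) a *
        condEntropy (Fintype.card 𝒳) (PMF.uniformOfFintype (Messages 𝒳 K L)) (𝒮.answer n a)
          (symbolsAt P) := fun n θ ℍ => by
    rw [condEntropy_jointLaw, tsum_map_mul]
    rfl
  refine Finset.sum_congr rfl fun n _ => ?_
  rw [hmarginal, 𝒮.isPrivate_iff.1 h𝒮 n θ θ' ℍ ℍ', hmarginal]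

lemma condDownload_le_download (θ : Fin K) (ℍ : CacheIndex M K) (P : Finset (Fin K × Fin L)) :
    𝒮.condDownload θ ℍ P ≤ 𝒮.download θ ℍ :=
  Finset.sum_le_sum fun _ _ => condEntropy_le_entropy ..

lemma inv_mul_condDownload_le (θ : Fin K) (ℍ : CacheIndex M K) (P : Finset (Fin K × Fin L)) :
    (N : ℝ≥0∞)⁻¹ * 𝒮.condDownload θ ℍ P ≤
      condEntropy (Fintype.card 𝒳) (𝒮.jointLaw θ ℍ) (fun ω n => 𝒮.ans n ω)
        fun ω => (ω.1, symbolsAt P ω.2) := by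
  rw [mul_comm, ← div_eq_mul_inv]
  refine ENNReal.div_le_of_le_mul' ?_
  refine (Finset.sum_le_card_nsmul _ _ _ fun n _ =>
    condEntropy_le_of_factorsThrough_left _ _ _ fun _ _ h => congrFun h n).trans_eq ?_
  rw [Finset.card_univ, Fintype.card_fin, nsmul_eq_mul]

end Nonempty

variable [Nontrivial 𝒳] (𝒮 : Scheme 𝒳 N K M L)

/-- `H(W_θ, A_1, …, A_N | Q_1, …, Q_N, W_P)` lies between the two sides. -/
lemma card_add_condDownload_le (r : Fin M → ℝ) (θ : Fin K) (ℍ : CacheIndex M K)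
    {P : Finset (Fin K × Fin L)} (hP : cachedPositions L r ℍ ⊆ P) :
    ((messagePositions L θ \ P).card : ℝ≥0∞) +
        (N : ℝ≥0∞)⁻¹ * 𝒮.condDownload θ ℍ (P ∪ messagePositions L θ) ≤
      𝒮.condDownload θ ℍ P + 𝒮.equivocation r θ ℍ := by
  set q := Fintype.card 𝒳
  set μ := 𝒮.jointLaw θ ℍ
  set W : (Fin N → 𝒮.Query) × Messages 𝒳 K L → Fin L → 𝒳 := fun ω => ω.2 θ
  set A : (Fin N → 𝒮.Query) × Messages 𝒳 K L → Fin N → 𝒮.Answer := fun ω n => 𝒮.ans n ω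
  set Y : (Fin N → 𝒮.Query) × Messages 𝒳 K L → (Fin N → 𝒮.Query) × (P → 𝒳) :=
    fun ω => (ω.1, symbolsAt P ω.2)
  have hunknown : ((messagePositions L θ \ P).card : ℝ≥0∞) = condEntropy q μ W Y := by
    rw [condEntropy_jointLaw 𝒮 q θ ℍ W (symbolsAt P)]
    simp only [W, q, condEntropy_uniformOfFintype_symbolsAt, ENNReal.tsum_mul_right,
      PMF.tsum_coe, one_mul]
  have hinterference : (N : ℝ≥0∞)⁻¹ * 𝒮.condDownload θ ℍ (P ∪ messagePositions L θ) ≤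
      condEntropy q μ A (fun ω => (W ω, Y ω)) :=
    (𝒮.inv_mul_condDownload_le ..).trans <|
      condEntropy_le_of_factorsThrough_right q μ A fun ω ω' h => by
        obtain ⟨hQ, hPθ⟩ := Prod.mk.inj h
        obtain ⟨hθ, hP⟩ := symbolsAt_union_messagePositions_eq_iff.1 hPθ
        exact Prod.ext hθ (Prod.ext hQ hP)
  have hanswers : condEntropy q μ A Y ≤ 𝒮.condDownload θ ℍ P := condEntropy_pi_le ..
  have hdecode : condEntropy q μ W (fun ω => (A ω, Y ω)) ≤ 𝒮.equivocation r θ ℍ :=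
    condEntropy_le_of_factorsThrough_right q μ W fun ω ω' h => by
      obtain ⟨hA, hY⟩ := Prod.mk.inj h
      obtain ⟨hQ, hW⟩ := Prod.mk.inj hY
      refine Prod.ext (funext₂ fun i l => ?_) (Prod.ext hQ hA)
      exact symbolsAt_eq_iff.1 hW (ℍ i, l.1) (hP (mem_cachedPositions.2 ⟨i, rfl, l.2⟩))
  calc
    _ ≤ condEntropy q μ W Y + condEntropy q μ A (fun ω => (W ω, Y ω)) := by
      rw [hunknown]
      gcongr
    _ = condEntropy q μ A Y + condEntropy q μ W (fun ω => (A ω, Y ω)) :=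
      condEntropy_add_condEntropy_comm ..
    _ ≤ _ := add_le_add hanswers hdecode

variable {𝒮}

lemma IsPrivate.sum_card_le_condDownload_add (h𝒮 : 𝒮.IsPrivate) (hN : 1 ≤ N) (r : Fin M → ℝ)
    (θ₀ : Fin K) (ℍ : CacheIndex M K) {m : ℕ} {σ : Fin m → Fin K} (hσ : Function.Injective σ)
    {P : Finset (Fin K × Fin L)} (hP : cachedPositions L r ℍ ⊆ P) :
    ∑ s : Fin m, (N : ℝ≥0∞)⁻¹ ^ (s : ℕ) * ((messagePositions L (σ s) \ P).card : ℝ≥0∞) ≤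
      𝒮.condDownload θ₀ ℍ P + ∑ s, 𝒮.equivocation r (σ s) ℍ := by
  induction m generalizing P with
  | zero => simp
  | succ m ih =>
    have hN1 : (N : ℝ≥0∞)⁻¹ ≤ 1 := ENNReal.inv_le_one.2 (by exact_mod_cast hN)
    set P' := P ∪ messagePositions L (σ 0) with hP'
    set e := ∑ s : Fin m, 𝒮.equivocation r (σ s.succ) ℍ
    have hdisj : ∀ s : Fin m,
        messagePositions L (σ s.succ) \ P' = messagePositions L (σ s.succ) \ P := fun s => by
      ext p
      simp only [hP', Finset.mem_sdiff, Finset.mem_union, mem_messagePositions, not_or]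
      refine and_congr_right fun hp => and_iff_left ?_
      rw [hp]
      exact hσ.ne (Fin.succ_ne_zero s)
    have htail := ih (hσ.comp (Fin.succ_injective m)) (hP.trans Finset.subset_union_left : _ ⊆ P')
    have hhead := 𝒮.card_add_condDownload_le r (σ 0) ℍ hP
    rw [h𝒮.condDownload_congr (σ 0) θ₀ ℍ ℍ, h𝒮.condDownload_congr (σ 0) θ₀ ℍ ℍ] at hhead
    simp only [Function.comp_apply, hdisj] at htail
    rw [Fin.sum_univ_succ, Fin.sum_univ_succ]
    simp only [Fin.val_zero, pow_zero, one_mul, Fin.val_succ, pow_succ', mul_assoc,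
      ← Finset.mul_sum]
    calc
      _ ≤ ((messagePositions L (σ 0) \ P).card : ℝ≥0∞) +
          (N : ℝ≥0∞)⁻¹ * (𝒮.condDownload θ₀ ℍ P' + e) := by gcongr
      _ ≤ ((messagePositions L (σ 0) \ P).card + (N : ℝ≥0∞)⁻¹ * 𝒮.condDownload θ₀ ℍ P') + e := by
        rw [mul_add, ← add_assoc]
        gcongr
        exact mul_le_of_le_one_left' hN1
      _ ≤ (𝒮.condDownload θ₀ ℍ P + 𝒮.equivocation r (σ 0) ℍ) + e := by gcongr
      _ = _ := add_assoc ..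

end Scheme

end Fintype

lemma card_messagePositions_sdiff_of_notMem (r : Fin M → ℝ) (ℍ : CacheIndex M K) {θ : Fin K}
    (hθ : ∀ i, ℍ i ≠ θ) : (messagePositions L θ \ cachedPositions L r ℍ).card = L := by
  rw [Finset.sdiff_eq_self_of_disjoint, card_messagePositions]
  refine Finset.disjoint_left.2 fun p hp hp' => ?_
  obtain ⟨i, hi, -⟩ := mem_cachedPositions.1 hp'
  exact hθ i (hi.trans (mem_messagePositions.1 hp))

lemma le_card_messagePositions_sdiff {r : Fin M → ℝ} {i : Fin M} (hi : 0 ≤ r i)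
    (ℍ : CacheIndex M K) :
    (1 - r i) * L ≤ (messagePositions L (ℍ i) \ cachedPositions L r ℍ).card := by
  have hsub : messagePositions L (ℍ i) ∩ cachedPositions L r ℍ ⊆
      {ℍ i} ×ˢ (Finset.univ.filter fun l : Fin L => (l : ℕ) < ⌊r i * L⌋₊) := by
    intro p hp
    obtain ⟨hp, hp'⟩ := Finset.mem_inter.1 hp
    rw [mem_messagePositions] at hp
    obtain ⟨j, hj, hjl⟩ := mem_cachedPositions.1 hp'
    obtain rfl := ℍ.injective (hj.trans hp)
    simp only [Finset.mem_product, Finset.mem_singleton, Finset.mem_filter, Finset.mem_univ,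
      true_and]
    exact ⟨hp, hjl⟩
  have hinter : (messagePositions L (ℍ i) ∩ cachedPositions L r ℍ).card ≤ ⌊r i * L⌋₊ := by
    refine (Finset.card_le_card hsub).trans ?_
    rw [Finset.card_product, Finset.card_singleton, one_mul, Fin.card_filter_val_lt]
    exact min_le_right _ _
  have hsum := Finset.card_sdiff_add_card_inter (messagePositions L (ℍ i)) (cachedPositions L r ℍ)
  rw [card_messagePositions] at hsum
  have hL : (L : ℝ) ≤ (messagePositions L (ℍ i) \ cachedPositions L r ℍ).card + ⌊r i * L⌋₊ := by
    exact_mod_cast hsum.ge.trans (Nat.add_le_add_left hinter _)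
  have hfloor : (⌊r i * L⌋₊ : ℝ) ≤ r i * L := Nat.floor_le (by positivity)
  linarith

/-- The closed form of the optimal normalized download cost. -/
def costFormula (N K M : ℕ) (r : Fin M → ℝ) : ℝ :=
  (∑ k ∈ Finset.range (K - M), 1 / (N : ℝ) ^ k) +
    ∑ i : Fin M, (1 - r i) / (N : ℝ) ^ (K - 1 - (i : ℕ))

lemma costFormula_mul_le_sum (N : ℕ) {r : Fin M → ℝ} (hM : M ≤ K) (hr0 : ∀ i, 0 ≤ r i) (L : ℕ) :
    costFormula N K M r * L ≤ ∑ s : Fin K, (N : ℝ)⁻¹ ^ (s : ℕ) *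
      (messagePositions L s.rev \ cachedPositions L r (Fin.castLEEmb hM)).card := by
  obtain ⟨n, rfl⟩ := Nat.exists_eq_add_of_le hM
  rw [← Equiv.sum_comp Fin.revPerm, Fin.sum_univ_add, costFormula, add_mul, Finset.sum_mul,
    Finset.sum_mul, add_comm]
  simp only [Fin.revPerm_apply, Fin.rev_rev, Fin.val_rev, Fin.val_castAdd, Fin.val_natAdd]
  refine add_le_add (Finset.sum_le_sum fun i _ => ?_) (le_of_eq ?_)
  · rw [show M + n - (i + 1) = M + n - 1 - i by omega, inv_pow, div_eq_inv_mul, mul_assoc]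
    gcongr
    exact le_card_messagePositions_sdiff (hr0 i) (Fin.castLEEmb hM)
  · rw [Nat.add_sub_cancel_left, ← Finset.sum_range_reflect, ← Fin.sum_univ_eq_sum_range]
    refine Finset.sum_congr rfl fun j _ => ?_
    rw [card_messagePositions_sdiff_of_notMem r _ fun i hi => ?_, one_div, inv_pow]
    · congr 3
      omega
    · have := congrArg Fin.val hi
      simp only [Fin.castLEEmb_apply, Fin.val_castLE, Fin.val_natAdd] at this
      omega

lemma Scheme.IsPrivate.ofReal_costFormula_mul_le [Fintype 𝒳] [Nontrivial 𝒳]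
    {𝒮 : Scheme 𝒳 N K M L} (h𝒮 : 𝒮.IsPrivate) (hN : 1 ≤ N) (hM : M ≤ K) {r : Fin M → ℝ}
    (hr0 : ∀ i, 0 ≤ r i) (θ : Fin K) (ℍ : CacheIndex M K) :
    ENNReal.ofReal (costFormula N K M r) * L ≤
      𝒮.download θ ℍ + ∑ θ', 𝒮.equivocation r θ' (Fin.castLEEmb hM) := by
  set ℍ₀ : CacheIndex M K := Fin.castLEEmb hM
  have hN0 : (0 : ℝ) < N := by exact_mod_cast hN
  calc
    _ ≤ ENNReal.ofReal (∑ s : Fin K, (N : ℝ)⁻¹ ^ (s : ℕ) *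
        (messagePositions L s.rev \ cachedPositions L r ℍ₀).card) := by
      rw [← ENNReal.ofReal_natCast, ← ENNReal.ofReal_mul' (by positivity)]
      exact ENNReal.ofReal_le_ofReal (costFormula_mul_le_sum N hM hr0 L)
    _ = ∑ s : Fin K, (N : ℝ≥0∞)⁻¹ ^ (s : ℕ) *
        (messagePositions L s.rev \ cachedPositions L r ℍ₀).card := by
      rw [ENNReal.ofReal_sum_of_nonneg fun s _ => by positivity]
      refine Finset.sum_congr rfl fun s _ => ?_
      rw [ENNReal.ofReal_mul (by positivity), ENNReal.ofReal_pow (by positivity),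
        ENNReal.ofReal_inv_of_pos hN0, ENNReal.ofReal_natCast, ENNReal.ofReal_natCast]
    _ ≤ 𝒮.condDownload θ ℍ₀ (cachedPositions L r ℍ₀) + ∑ s, 𝒮.equivocation r (Fin.rev s) ℍ₀ :=
      h𝒮.sum_card_le_condDownload_add hN r θ ℍ₀ Fin.rev_injective subset_rfl
    _ ≤ _ := by
      rw [h𝒮.download_congr θ θ ℍ ℍ₀, ← Equiv.sum_comp Fin.revPerm fun θ' => 𝒮.equivocation r θ' ℍ₀]
      exact add_le_add (𝒮.condDownload_le_download ..) le_rfl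

lemma ofReal_costFormula_le_of_isAchievable [Fintype 𝒳] [Nontrivial 𝒳] (hN : 1 ≤ N) (hK : 1 ≤ K)
    (hM : M ≤ K) {r : Fin M → ℝ} (hr0 : ∀ i, 0 ≤ r i) {d : ℝ≥0∞}
    (hd : IsAchievable 𝒳 N K M r d) : ENNReal.ofReal (costFormula N K M r) ≤ d := by
  obtain ⟨L, 𝒮, hL, hpriv, hequiv, hdown⟩ := hd
  set ℍ : CacheIndex M K := Fin.castLEEmb hM
  have hlim : Filter.Tendsto (fun j => (𝒮 j).download ⟨0, hK⟩ ℍ / (L j : ℝ≥0∞) +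
      ∑ θ, (𝒮 j).equivocation r θ ℍ / (L j : ℝ≥0∞)) Filter.atTop (𝓝 (d + ∑ _θ : Fin K, 0)) :=
    (hdown _ ℍ).add (tendsto_finsetSum _ fun θ _ => hequiv θ ℍ)
  rw [Finset.sum_const_zero, add_zero] at hlim
  refine ge_of_tendsto hlim ?_
  filter_upwards [hL.eventually_ge_atTop 1] with j hj
  simp only [div_eq_mul_inv, ← Finset.sum_mul, ← add_mul]
  have hL0 : (L j : ℝ≥0∞) ≠ 0 := by exact_mod_cast Nat.one_le_iff_ne_zero.1 hj
  rw [← div_eq_mul_inv,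
    ENNReal.le_div_iff_mul_le (.inl hL0) (.inl (ENNReal.natCast_ne_top _))]
  exact (hpriv j).ofReal_costFormula_mul_le hN hM hr0 _ ℍ

end Converse

section RetrievalCode

/-- The first `card J - s` power sums of `x` with nodes `α`: the syndrome of `x` for a Reed–Solomon
code, which is all that someone who knows `s` entries of `x` needs in order to recover `x`. -/
def syndrome {F J : Type*} [Field F] [Fintype J] (α : J → F) (s : ℕ) (x : J → F) :
    Fin (Fintype.card J - s) → F :=
  fun i => ∑ j, x j * α j ^ (i : ℕ)

lemma eq_of_syndrome_eq {F J : Type*} [Field F] [Fintype J] {α : J → F}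
    (hα : Function.Injective α) {s : ℕ} {x y : J → F} (h : syndrome α s x = syndrome α s y)
    {Z : Finset J} (hZ : s ≤ Z.card) (hxy : ∀ j ∈ Z, x j = y j) : x = y := by
  classical
  set e : Fin Zᶜ.card ≃ {j // j ∈ Zᶜ} := Zᶜ.equivFin.symm
  have hpower : ∀ i : Fin Zᶜ.card, ∑ j ∈ Zᶜ, (x j - y j) * α j ^ (i : ℕ) = 0 := fun i => by
    have hi : (i : ℕ) < Fintype.card J - s :=
      i.2.trans_le ((Finset.card_compl Z).trans_le (Nat.sub_le_sub_left hZ _))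
    calc
      _ = ∑ j, (x j - y j) * α j ^ (i : ℕ) :=
        Finset.sum_subset (Finset.subset_univ _) fun j _ hj => by
          rw [hxy j (by simpa using hj), sub_self, zero_mul]
      _ = syndrome α s x ⟨i, hi⟩ - syndrome α s y ⟨i, hi⟩ := by
        simp only [syndrome, sub_mul, Finset.sum_sub_distrib]
      _ = 0 := by rw [h, sub_self]
  have hvandermonde : (fun i => x (e i) - y (e i)) = 0 := by
    refine Matrix.eq_zero_of_forall_pow_sum_mul_pow_eq_zero (f := fun i => α (e i))
      (hα.comp (Subtype.val_injective.comp e.injective)) fun i => ?_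
    rw [Equiv.sum_comp e fun j : {j // j ∈ Zᶜ} => (x j - y j) * α j ^ (i : ℕ),
      Finset.sum_coe_sort Zᶜ fun j => (x j - y j) * α j ^ (i : ℕ), hpower]
  funext j
  by_cases hj : j ∈ Z
  · exact hxy j hj
  · have := congrFun hvandermonde (e.symm ⟨j, Finset.mem_compl.2 hj⟩)
    simpa only [Equiv.apply_symm_apply, Pi.zero_apply, sub_eq_zero] using this

/-- A retrieval code without side information for messages `C → F`, uniform in the abelian group
`F`: the queries do not depend on `F`, and each database returns an element of `J → F`. Although
the code ignores side information, whoever knows `m` of the messages can compute `known m` entries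
of each answer in advance; the field `cost` counts the other entries. -/
structure RetrievalCode (N K : ℕ) where
  /-- the queries -/
  Query : Type
  /-- the positions of an answer -/
  J : Type
  /-- the positions of a message -/
  C : Type
  [fintypeJ : Fintype J]
  [fintypeC : Fintype C]
  [nonemptyC : Nonempty C]
  /-- the number of answer symbols known to whoever knows `m` messages -/
  known : ℕ → ℕ
  /-- the joint law of the queries -/
  law : Fin K → PMF (Fin N → Query)
  /-- the answers -/
  answer : ∀ (F : Type) [AddCommGroup F], Fin N → Query → (Fin K → C → F) → J → F
  law_map_eq : ∀ n θ θ', (law θ).map (fun Q => Q n) = (law θ').map fun Q => Q n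
  decode : ∀ (F : Type) [AddCommGroup F] (θ : Fin K), ∀ Q ∈ (law θ).support, ∀ v v',
    (∀ n, answer F n (Q n) v = answer F n (Q n) v') → v θ = v' θ
  exists_known : ∀ (F : Type) [AddCommGroup F] (n : Fin N) (a : Query) (S : Finset (Fin K)),
    ∃ Z : Finset J, known S.card ≤ Z.card ∧ ∀ v v' : Fin K → C → F,
      (∀ k ∈ S, v k = v' k) → ∀ j ∈ Z, answer F n a v j = answer F n a v' j
  cost : ∀ m ≤ K, (N : ℝ) * (Fintype.card J - known m : ℕ) =
    Fintype.card C * ∑ k ∈ Finset.range (K - m), 1 / (N : ℝ) ^ k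

attribute [instance] RetrievalCode.fintypeJ RetrievalCode.fintypeC RetrievalCode.nonemptyC

/-- The retrieval code in which a single database returns all messages. -/
def downloadEverything (K : ℕ) : RetrievalCode 1 K where
  Query := Unit
  J := Fin K
  C := Unit
  known := id
  law _ := PMF.pure fun _ => ()
  answer _ _ _ _ v k := v k ()
  law_map_eq _ _ _ := rfl
  decode _ _ θ _ _ _ _ h := funext fun _ => congrFun (h 0) θ
  exists_known _ _ _ _ S := ⟨S, le_rfl, fun _ _ h k hk => congrFun (h k hk) ()⟩
  cost m _ := by simp

section PermutedSums

/-- The symbol number `x` of run `j` of a message `u`, where number `0` stands for the neutral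
element. -/
def paddedSymbol {F J G : Type*} [Zero F] [Zero G] [DecidableEq G]
    (u : J × {x : G // x ≠ 0} → F) (j : J) (x : G) : F :=
  if h : x ≠ 0 then u (j, ⟨x, h⟩) else 0

lemma paddedSymbol_zero {F J G : Type*} [Zero F] [Zero G] [DecidableEq G]
    (u : J × {x : G // x ≠ 0} → F) (j : J) : paddedSymbol u j 0 = 0 :=
  dif_neg (not_not.2 rfl)

lemma paddedSymbol_val {F J G : Type*} [Zero F] [Zero G] [DecidableEq G]
    (u : J × {x : G // x ≠ 0} → F) (j : J) (x : {x : G // x ≠ 0}) :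
    paddedSymbol u j x = u (j, x) :=
  dif_pos x.2

lemma sum_paddedSymbol_add_single {ι F J G : Type*} [Fintype ι] [DecidableEq ι] [AddCommMonoid F]
    [AddZeroClass G] [DecidableEq G] (v : ι → J × {x : G // x ≠ 0} → F) (j : J) (y : ι → G)
    (i : ι) (x : G) :
    ∑ k, paddedSymbol (v k) j ((y + Pi.single i x : ι → G) k) =
      paddedSymbol (v i) j (y i + x) + ∑ k ∈ Finset.univ.erase i, paddedSymbol (v k) j (y k) := by
  rw [← Finset.add_sum_erase _ _ (Finset.mem_univ i), Pi.add_apply, Pi.single_eq_same]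
  congr 1
  refine Finset.sum_congr rfl fun k hk => ?_
  rw [Pi.add_apply, Pi.single_eq_of_ne (Finset.ne_of_mem_erase hk), add_zero]

lemma uniformOfFintype_map_equiv {α β : Type*} [Fintype α] [Nonempty α] [Fintype β] [Nonempty β]
    (e : α ≃ β) : (PMF.uniformOfFintype α).map e = PMF.uniformOfFintype β := by
  classical
  ext b
  rw [PMF.map_apply, tsum_eq_single (e.symm b) fun a ha => if_neg fun h => ha (by simp [h])]
  simp [Fintype.card_congr e]

variable {N K : ℕ} [NeZero N]

/-- The law of `n ↦ (j ↦ π j + n • e_θ)` for a uniformly random permutation `π` of `(ℤ/N) ^ K`. -/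
def shiftedPermLaw (θ : Fin K) : PMF (Fin N → Equiv.Perm (Fin K → Fin N)) :=
  (PMF.uniformOfFintype (Equiv.Perm (Fin K → Fin N))).map fun π n =>
    Equiv.addRight (Pi.single θ n) * π

lemma shiftedPermLaw_map (θ : Fin K) (n : Fin N) :
    (shiftedPermLaw θ).map (fun Q => Q n) =
      PMF.uniformOfFintype (Equiv.Perm (Fin K → Fin N)) := by
  have hmul : (fun Q : Fin N → Equiv.Perm (Fin K → Fin N) => Q n) ∘
      (fun π n => Equiv.addRight (Pi.single θ n) * π) =
      Equiv.mulLeft (Equiv.addRight (Pi.single θ n)) := rfl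
  rw [shiftedPermLaw, PMF.map_comp, hmul, uniformOfFintype_map_equiv]

lemma eq_of_forall_sum_paddedSymbol_eq {F : Type*} [AddCommGroup F] {θ : Fin K}
    {Q : Fin N → Equiv.Perm (Fin K → Fin N)} (hQ : Q ∈ (shiftedPermLaw θ).support)
    {v v' : Fin K → (Fin K → Fin N) × {x : Fin N // x ≠ 0} → F}
    (h : ∀ n j, ∑ k, paddedSymbol (v k) j (Q n j k) = ∑ k, paddedSymbol (v' k) j (Q n j k)) :
    v θ = v' θ := by
  simp only [shiftedPermLaw, PMF.mem_support_map_iff, PMF.support_uniformOfFintype] at hQ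
  obtain ⟨π, -, rfl⟩ := hQ
  simp only [Equiv.Perm.mul_apply, Equiv.coe_addRight, sum_paddedSymbol_add_single] at h
  funext ⟨j, x⟩
  have hinterference := h (-π j θ) j
  have hsymbol := h (x - π j θ) j
  simp only [add_neg_cancel, paddedSymbol_zero, zero_add] at hinterference
  rw [add_sub_cancel, paddedSymbol_val, paddedSymbol_val, hinterference] at hsymbol
  exact add_right_cancel hsymbol

lemma exists_known_sums (F : Type*) [AddCommMonoid F] (π : Equiv.Perm (Fin K → Fin N))
    (S : Finset (Fin K)) :
    ∃ Z : Finset (Fin K → Fin N), N ^ S.card ≤ Z.card ∧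
      ∀ v v' : Fin K → (Fin K → Fin N) × {x : Fin N // x ≠ 0} → F, (∀ k ∈ S, v k = v' k) →
        ∀ j ∈ Z, ∑ k, paddedSymbol (v k) j (π j k) = ∑ k, paddedSymbol (v' k) j (π j k) := by
  refine ⟨(Finset.univ.filter fun y : Fin K → Fin N => ∀ k ∈ Sᶜ, y k = 0).map
    π.symm.toEmbedding, ?_, fun v v' hv j hj => Finset.sum_congr rfl fun k _ => ?_⟩
  · have hcard := card_filter_forall_mem_eq Sᶜ (0 : Fin K → Fin N)
    simp only [Pi.zero_apply, compl_compl, Fintype.card_fin] at hcard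
    rw [Finset.card_map, hcard]
  · rw [Finset.mem_map_equiv, Equiv.symm_symm, Finset.mem_filter] at hj
    by_cases hk : k ∈ S
    · rw [hv k hk]
    · rw [hj.2 k (Finset.mem_compl.2 hk), paddedSymbol_zero, paddedSymbol_zero]

lemma mul_pow_add_sub_pow_eq {x : ℝ} (hx : x ≠ 0) (m c : ℕ) :
    x * (x ^ (m + c) - x ^ m) = x ^ (m + c) * (x - 1) * ∑ k ∈ Finset.range c, 1 / x ^ k := by
  have hgeom : x ^ c * (x - 1) * ∑ k ∈ Finset.range c, 1 / x ^ k = x * (x ^ c - 1) := by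
    induction c with
    | zero => simp
    | succ c ih =>
      rw [Finset.sum_range_succ, pow_succ, mul_add, show x ^ c * x * (x - 1) *
        ∑ k ∈ Finset.range c, 1 / x ^ k = x * (x * (x ^ c - 1)) by rw [← ih]; ring]
      field_simp
      ring
  rw [pow_add]
  linear_combination (-x ^ m) * hgeom

/-- The retrieval code for `N ≥ 2` databases. In each of `N ^ K` runs, database `n` is asked for
the sum of one symbol of each message. In what order the `N ^ K` possible choices of symbols appear
is random. Only the symbol of the desired message depends on `n`, and it runs through all
symbols. -/
def permutedSums (N K : ℕ) [NeZero N] (hN : 2 ≤ N) : RetrievalCode N K where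
  Query := Equiv.Perm (Fin K → Fin N)
  J := Fin K → Fin N
  C := (Fin K → Fin N) × {x : Fin N // x ≠ 0}
  nonemptyC := ⟨0, ⟨⟨1, hN⟩, fun h => by simpa using congrArg Fin.val h⟩⟩
  known m := N ^ m
  law := shiftedPermLaw
  answer _ _ _ π v j := ∑ k, paddedSymbol (v k) j (π j k)
  law_map_eq n θ θ' := by rw [shiftedPermLaw_map, shiftedPermLaw_map]
  decode _ _ _ _ hQ _ _ h := eq_of_forall_sum_paddedSymbol_eq hQ fun n j => congrFun (h n) j
  exists_known F _ _ π S := exists_known_sums F π S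
  cost m hm := by
    obtain ⟨c, rfl⟩ := Nat.exists_eq_add_of_le hm
    have hC : Fintype.card {x : Fin N // x ≠ 0} = N - 1 := by
      simp [Fintype.card_subtype_compl]
    rw [Fintype.card_prod, hC, Fintype.card_pi_const, Fintype.card_fin, add_tsub_cancel_left,
      Nat.cast_sub (Nat.pow_le_pow_right (NeZero.pos N) hm)]
    push_cast [Nat.cast_sub (NeZero.one_le (n := N))]
    exact mul_pow_add_sub_pow_eq (NeZero.ne _) m c

end PermutedSums

lemma nonempty_retrievalCode {N : ℕ} (hN : 1 ≤ N) (K : ℕ) : Nonempty (RetrievalCode N K) := by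
  rcases hN.eq_or_lt with rfl | hN2
  · exact ⟨downloadEverything K⟩
  · have : NeZero N := ⟨by omega⟩
    exact ⟨permutedSums N K hN2⟩

end RetrievalCode

section Achievability

variable {𝒳 : Type*} {N K M : ℕ}

/-- Block number `t` of a message that is cut into `B` blocks of length `D`. -/
def block {B D : ℕ} (t : Fin B) (u : Fin (B * D) → 𝒳) : Fin D → 𝒳 :=
  fun x => u (finProdFinEquiv (t, x))

lemma eq_of_forall_block_eq {B D : ℕ} {u u' : Fin (B * D) → 𝒳} (h : ∀ t, block t u = block t u') :
    u = u' := by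
  funext l
  have := congrFun (h (finProdFinEquiv.symm l).1) (finProdFinEquiv.symm l).2
  simpa only [block, Prod.mk.eta, Equiv.apply_symm_apply] using this

/-- The ranks `i` of which block `t`, out of `B`, is cached entirely. -/
def cachedRanks (r : Fin M → ℝ) (B : ℕ) (t : Fin B) : Finset (Fin M) :=
  Finset.univ.filter fun i => (t : ℕ) < ⌊r i * B⌋₊

lemma mem_cachedRanks {r : Fin M → ℝ} {B : ℕ} {t : Fin B} {i : Fin M} :
    i ∈ cachedRanks r B t ↔ (t : ℕ) < ⌊r i * B⌋₊ := by
  simp only [cachedRanks, Finset.mem_filter, Finset.mem_univ, true_and]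

lemma card_cachedRanks_le (r : Fin M → ℝ) (B : ℕ) (t : Fin B) : (cachedRanks r B t).card ≤ M :=
  (Finset.card_le_univ _).trans_eq (Fintype.card_fin M)

lemma block_eq_of_cached_eq {r : Fin M → ℝ} {ℍ : CacheIndex M K} {B D : ℕ}
    {w w' : Messages 𝒳 K (B * D)} (h : cached r ℍ w = cached r ℍ w') {t : Fin B} {i : Fin M}
    (hi : i ∈ cachedRanks r B t) : block t (w (ℍ i)) = block t (w' (ℍ i)) := by
  funext x
  refine congrFun (congrFun h i) ⟨finProdFinEquiv (t, x), ?_⟩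
  have hfloor : ((t + 1 : ℕ) : ℝ) ≤ r i * B :=
    (Nat.le_floor_iff' (Nat.succ_ne_zero _)).1 (mem_cachedRanks.1 hi)
  have hblock : (t + 1) * D ≤ ⌊r i * (B * D : ℕ)⌋₊ := by
    refine Nat.le_floor ?_
    push_cast at hfloor ⊢
    rw [← mul_assoc]
    gcongr
  refine lt_of_lt_of_le ?_ hblock
  rw [finProdFinEquiv_apply_val, add_mul, one_mul, mul_comm D, add_comm]
  exact Nat.add_lt_add_left x.2 _

/-- The scheme in which the messages are cut into `B` blocks of length `D`, each of which is
embedded into `R.C → F` by `φ`. All blocks are retrieved by the same queries of `R`, but the answers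
for a block are compressed to as many symbols as a user who has cached the block of some messages
lacks. -/
def blockScheme (R : RetrievalCode N K) {F : Type} [Field F] (α : R.J → F) (r : Fin M → ℝ)
    (B : ℕ) {D : ℕ} (φ : (Fin D → 𝒳) → R.C → F) : Scheme 𝒳 N K M (B * D) where
  Query := R.Query
  Answer := (t : Fin B) → Fin (Fintype.card R.J - R.known (cachedRanks r B t).card) → F
  queryLaw θ _ := R.law θ
  answer n a w t := syndrome α _ (R.answer F n a fun k => φ (block t (w k)))

section blockScheme

variable [Fintype 𝒳] (R : RetrievalCode N K) {F : Type} [Field F] {α : R.J → F}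
  (r : Fin M → ℝ) {B D : ℕ} {φ : (Fin D → 𝒳) → R.C → F}

lemma blockScheme_isPrivate [Nonempty 𝒳] : (blockScheme R α r B φ).IsPrivate :=
  (Scheme.isPrivate_iff _).2 fun n θ θ' _ _ => R.law_map_eq n θ θ'

lemma blockScheme_equivocation [Nonempty 𝒳] (hα : Function.Injective α)
    (hφ : Function.Injective φ) (θ : Fin K) (ℍ : CacheIndex M K) :
    (blockScheme R α r B φ).equivocation r θ ℍ = 0 := by
  refine condEntropy_eq_zero _ ?_
  rintro ⟨Q, w⟩ hω ⟨Q', w'⟩ - h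
  simp only [Prod.mk.injEq] at h
  obtain ⟨hcache, rfl, hans⟩ := h
  have hQ : Q ∈ (R.law θ).support := by
    simp only [Scheme.jointLaw, PMF.mem_support_bind_iff, PMF.mem_support_map_iff] at hω
    obtain ⟨Q₀, hQ₀, w₀, -, hw₀⟩ := hω
    exact (Prod.mk.inj hw₀).1 ▸ hQ₀
  refine eq_of_forall_block_eq fun t => hφ <| R.decode F θ Q hQ (fun k => φ (block t (w k)))
    (fun k => φ (block t (w' k))) fun n => ?_
  obtain ⟨Z, hZ, hknown⟩ := R.exists_known F n (Q n) ((cachedRanks r B t).map ℍ)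
  rw [Finset.card_map] at hZ
  refine eq_of_syndrome_eq hα (congrFun (congrFun hans n) t) hZ (hknown _ _ fun k hk => ?_)
  obtain ⟨i, hi, rfl⟩ := Finset.mem_map.1 hk
  rw [block_eq_of_cached_eq hcache hi]

lemma blockScheme_download_le [Nonempty 𝒳] [Fintype F] (hM : M ≤ K) (θ : Fin K)
    (ℍ : CacheIndex M K) :
    (blockScheme R α r B φ).download θ ℍ ≤ ENNReal.ofReal
      (Fintype.card R.C * Real.logb (Fintype.card 𝒳) (Fintype.card F) *
        ∑ t : Fin B, ∑ k ∈ Finset.range (K - (cachedRanks r B t).card), 1 / (N : ℝ) ^ k) := by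
  set ℓ := Real.logb (Fintype.card 𝒳) (Fintype.card F)
  have hcard : Real.logb (Fintype.card 𝒳) (Fintype.card ((t : Fin B) →
      Fin (Fintype.card R.J - R.known (cachedRanks r B t).card) → F)) =
      ∑ t : Fin B, (Fintype.card R.J - R.known (cachedRanks r B t).card : ℕ) * ℓ := by
    rw [Fintype.card_pi, Nat.cast_prod, Real.logb_prod _ _ fun t _ => by simp]
    refine Finset.sum_congr rfl fun t _ => ?_
    rw [Fintype.card_pi_const, Nat.cast_pow, Real.logb_pow]
  have hans : ∀ n, entropy (Fintype.card 𝒳) ((blockScheme R α r B φ).jointLaw θ ℍ)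
      ((blockScheme R α r B φ).ans n) ≤ ENNReal.ofReal
      (∑ t : Fin B, (Fintype.card R.J - R.known (cachedRanks r B t).card : ℕ) * ℓ) := fun n => by
    rw [← hcard]
    exact entropy_le_logb_card (α := (t : Fin B) →
      Fin (Fintype.card R.J - R.known (cachedRanks r B t).card) → F) ..
  refine (Finset.sum_le_sum fun n _ => hans n).trans_eq ?_
  rw [Finset.sum_const, Finset.card_univ, Fintype.card_fin, nsmul_eq_mul,
    ← ENNReal.ofReal_natCast, ← ENNReal.ofReal_mul (by positivity), Finset.mul_sum,
    Finset.mul_sum]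
  congr 1
  refine Finset.sum_congr rfl fun t _ => ?_
  rw [← mul_assoc, R.cost _ ((card_cachedRanks_le r B t).trans hM)]
  ring

end blockScheme

lemma card_filter_notMem_cachedRanks_le {r : Fin M → ℝ} {i : Fin M} (hi : r i ≤ 1) (B : ℕ) :
    ((Finset.univ.filter fun t : Fin B => i ∉ cachedRanks r B t).card : ℝ) ≤
      (1 - r i) * B + 1 := by
  have hfloor : ⌊r i * B⌋₊ ≤ B := Nat.floor_le_of_le (mul_le_of_le_one_left (by positivity) hi)
  have hcard : (Finset.univ.filter fun t : Fin B => i ∉ cachedRanks r B t).card =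
      B - ⌊r i * B⌋₊ := by
    simp only [mem_cachedRanks]
    rw [← Finset.compl_filter, Finset.card_compl, Fintype.card_fin, Fin.card_filter_val_lt,
      min_eq_right hfloor]
  rw [hcard, Nat.cast_sub hfloor]
  linarith [Nat.lt_floor_add_one (r i * B)]

lemma notMem_cachedRanks_of_card_le {r : Fin M → ℝ} (hr : Antitone r) {B : ℕ} {t : Fin B}
    {i : Fin M} (h : (cachedRanks r B t).card ≤ i) : i ∉ cachedRanks r B t := by
  intro hi
  have hsub : Finset.Iic i ⊆ cachedRanks r B t := fun j hj => mem_cachedRanks.2 <|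
    (mem_cachedRanks.1 hi).trans_le <| Nat.floor_le_floor <|
      mul_le_mul_of_nonneg_right (hr (Finset.mem_Iic.1 hj)) (Nat.cast_nonneg B)
  have hcard := Finset.card_le_card hsub
  rw [Fin.card_Iic] at hcard
  omega

lemma sum_range_sub_eq_add {R : Type*} [AddCommMonoid R] {m : ℕ} (hM : M ≤ K) (hm : m ≤ M)
    (g : ℕ → R) :
    ∑ k ∈ Finset.range (K - m), g k = ∑ k ∈ Finset.range (K - M), g k +
      ∑ i : Fin M, if m ≤ (i : ℕ) then g (K - 1 - i) else 0 := by
  induction M, hm using Nat.le_induction with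
  | base =>
    rw [Finset.sum_eq_zero (s := (Finset.univ : Finset (Fin m))) fun i _ => if_neg (by omega),
      add_zero]
  | succ M hm ih =>
    rw [ih (by omega), Fin.sum_univ_castSucc, show K - M = K - (M + 1) + 1 by omega,
      Finset.sum_range_succ]
    simp only [Fin.val_castSucc, Fin.val_last, if_pos hm]
    rw [show K - 1 - M = K - (M + 1) by omega, add_assoc, add_comm (g _), ← add_assoc]

lemma sum_block_cost_le {r : Fin M → ℝ} (hN : 1 ≤ N) (hM : M ≤ K) (hr1 : ∀ i, r i ≤ 1)
    (hr : Antitone r) (B : ℕ) :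
    ∑ t : Fin B, ∑ k ∈ Finset.range (K - (cachedRanks r B t).card), 1 / (N : ℝ) ^ k ≤
      B * costFormula N K M r + M := by
  set g : ℕ → ℝ := fun k => 1 / (N : ℝ) ^ k with hg
  have hg0 : ∀ k, 0 ≤ g k := fun k => by positivity
  have hg1 : ∀ k, g k ≤ 1 := fun k =>
    div_le_one_of_le₀ (one_le_pow₀ (by exact_mod_cast hN)) (by positivity)
  have hblock : ∀ t : Fin B, ∑ k ∈ Finset.range (K - (cachedRanks r B t).card), g k ≤
      ∑ k ∈ Finset.range (K - M), g k +
        ∑ i : Fin M, if i ∉ cachedRanks r B t then g (K - 1 - i) else 0 := fun t => by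
    rw [sum_range_sub_eq_add hM (card_cachedRanks_le r B t) g]
    gcongr with i
    by_cases hi : (cachedRanks r B t).card ≤ i
    · rw [if_pos hi, if_pos (notMem_cachedRanks_of_card_le hr hi)]
    · rw [if_neg hi]
      exact ite_nonneg (hg0 _) le_rfl
  calc
    _ ≤ _ := Finset.sum_le_sum fun t _ => hblock t
    _ = B * ∑ k ∈ Finset.range (K - M), g k + ∑ i : Fin M,
        ((Finset.univ.filter fun t : Fin B => i ∉ cachedRanks r B t).card : ℝ) *
          g (K - 1 - i) := by
      rw [Finset.sum_add_distrib, Finset.sum_const, Finset.card_univ, Fintype.card_fin,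
        nsmul_eq_mul, Finset.sum_comm]
      simp only [← Finset.sum_filter, Finset.sum_const, nsmul_eq_mul]
    _ ≤ B * ∑ k ∈ Finset.range (K - M), g k +
        ∑ i : Fin M, (B * ((1 - r i) * g (K - 1 - i)) + 1) := by
      gcongr with i
      have := mul_le_mul_of_nonneg_right (card_filter_notMem_cachedRanks_le (hr1 i) B)
        (hg0 (K - 1 - i))
      linarith [hg1 (K - 1 - i)]
    _ = _ := by
      rw [Finset.sum_add_distrib, ← Finset.mul_sum, costFormula]
      simp only [hg, Finset.sum_const, Finset.card_univ, Fintype.card_fin, nsmul_eq_mul,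
        mul_one, mul_one_div]
      ring

lemma exists_prime_pow_lt_and_le_pow_succ {q : ℕ} (hq : 2 ≤ q) (T : ℕ) :
    ∃ p, p.Prime ∧ q ^ T < p ∧ p ≤ q ^ (T + 1) := by
  obtain ⟨p, hp, hlt, hle⟩ := Nat.exists_prime_lt_and_le_two_mul (q ^ T) (by positivity)
  refine ⟨p, hp, hlt, hle.trans ?_⟩
  rw [pow_succ']
  exact Nat.mul_le_mul_right _ hq

lemma exists_scheme_download_le [Fintype 𝒳] [Nontrivial 𝒳] (R : RetrievalCode N K)
    {r : Fin M → ℝ} (hN : 1 ≤ N) (hM : M ≤ K) (hr1 : ∀ i, r i ≤ 1) (hr : Antitone r) {T : ℕ}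
    (hT : Fintype.card R.J ≤ T) :
    ∃ 𝒮 : Scheme 𝒳 N K M (T * (Fintype.card R.C * T)), 𝒮.IsPrivate ∧
      (∀ θ ℍ, 𝒮.equivocation r θ ℍ = 0) ∧
      ∀ θ ℍ, 𝒮.download θ ℍ ≤ ENNReal.ofReal
        (Fintype.card R.C * (T + 1) * (T * costFormula N K M r + M)) := by
  classical
  set q := Fintype.card 𝒳
  have hq : 1 < q := Fintype.one_lt_card
  obtain ⟨p, hp, hqp, hpq⟩ := exists_prime_pow_lt_and_le_pow_succ hq T
  have : Fact p.Prime := ⟨hp⟩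
  have hcard : Fintype.card (ZMod p) = p := ZMod.card p
  obtain ⟨α⟩ : Nonempty (R.J ↪ ZMod p) := by
    refine Function.Embedding.nonempty_of_card_le ?_
    rw [hcard]
    exact hT.trans ((Nat.lt_pow_self hq).trans hqp).le
  obtain ⟨φ⟩ : Nonempty ((Fin (Fintype.card R.C * T) → 𝒳) ↪ (R.C → ZMod p)) := by
    refine Function.Embedding.nonempty_of_card_le ?_
    rw [Fintype.card_pi_const, Fintype.card_fun, hcard, mul_comm, pow_mul]
    exact Nat.pow_le_pow_left hqp.le _
  have hlog : Real.logb q (Fintype.card (ZMod p)) ≤ T + 1 := by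
    rw [hcard, Real.logb_le_iff_le_rpow (by exact_mod_cast hq) (by exact_mod_cast hp.pos)]
    exact_mod_cast hpq
  refine ⟨blockScheme R α r T φ, blockScheme_isPrivate R r,
    blockScheme_equivocation R r α.injective φ.injective, fun θ ℍ =>
    (blockScheme_download_le R r hM θ ℍ).trans (ENNReal.ofReal_le_ofReal ?_)⟩
  exact mul_le_mul (mul_le_mul_of_nonneg_left hlog (Nat.cast_nonneg _))
    (sum_block_cost_le hN hM hr1 hr T) (by positivity) (by positivity)

lemma tendsto_one_add_inv_mul (d m : ℝ) :
    Filter.Tendsto (fun T : ℕ => (1 + (T : ℝ)⁻¹) * (d + m * (T : ℝ)⁻¹)) Filter.atTop (𝓝 d) := by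
  have hinv : Filter.Tendsto (fun T : ℕ => (T : ℝ)⁻¹) Filter.atTop (𝓝 0) :=
    tendsto_inv_atTop_nhds_zero_nat
  simpa only [add_zero, mul_zero, one_mul] using
    (hinv.const_add 1).mul ((hinv.const_mul m).const_add d)

lemma isAchievable_costFormula [Fintype 𝒳] [Nontrivial 𝒳] {r : Fin M → ℝ} (hN : 1 ≤ N)
    (hM : M ≤ K) (hr0 : ∀ i, 0 ≤ r i) (hr1 : ∀ i, r i ≤ 1) (hr : Antitone r) :
    IsAchievable 𝒳 N K M r (ENNReal.ofReal (costFormula N K M r)) := by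
  obtain ⟨R⟩ := nonempty_retrievalCode hN K
  set d := costFormula N K M r
  set c := Fintype.card R.C
  have hc : 0 < c := Fintype.card_pos
  set T : ℕ → ℕ := fun j => j + (Fintype.card R.J + 1)
  have hT : Filter.Tendsto T Filter.atTop Filter.atTop := Filter.tendsto_add_atTop_nat _
  have hT0 : ∀ j, 0 < T j := fun j => by positivity
  choose 𝒮 hpriv hequiv hdown using fun j => exists_scheme_download_le (𝒳 := 𝒳) R hN hM hr1 hr
    (show Fintype.card R.J ≤ T j from le_add_left (Nat.le_succ _))
  have hL : ∀ j, T j * (c * T j) ≠ 0 := fun j => by have := hT0 j; positivity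
  refine ⟨fun j => T j * (c * T j), 𝒮, ?_, hpriv, fun θ ℍ => by simp [hequiv], fun θ ℍ => ?_⟩
  · exact Filter.tendsto_atTop_mono (fun j => Nat.le_mul_of_pos_right _ (Nat.mul_pos hc (hT0 j))) hT
  refine tendsto_of_tendsto_of_tendsto_of_le_of_le tendsto_const_nhds
    ((ENNReal.continuous_ofReal.tendsto d).comp ((tendsto_one_add_inv_mul d M).comp hT))
    (fun j => ?_) (fun j => ?_)
  · have hlower := (hpriv j).ofReal_costFormula_mul_le hN hM hr0 θ ℍ
    simp only [hequiv, Finset.sum_const_zero, add_zero] at hlower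
    exact (ENNReal.le_div_iff_mul_le (.inl (by exact_mod_cast hL j))
      (.inl (ENNReal.natCast_ne_top _))).2 hlower
  · refine ENNReal.div_le_of_le_mul ((hdown j θ ℍ).trans_eq ?_)
    have hTj : (T j : ℝ) ≠ 0 := by exact_mod_cast (hT0 j).ne'
    rw [Function.comp_apply, Function.comp_apply, ← ENNReal.ofReal_natCast,
      ← ENNReal.ofReal_mul' (by positivity)]
    congr 1
    push_cast
    field_simp
    ring

end Achievability

end

end PIRPSI

theorem theorem1 (𝒳 : Type*) [Fintype 𝒳] [Nontrivial 𝒳] (N K M : ℕ)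
    (hN : 1 ≤ N) (hK : 1 ≤ K) (hM : M ≤ K)
    (r : Fin M → ℝ) (hr0 : ∀ i, 0 ≤ r i) (hr1 : ∀ i, r i ≤ 1) (hr : Antitone r) :
    PIRPSI.optimalCost 𝒳 N K M r =
      ENNReal.ofReal
        ((∑ k ∈ Finset.range (K - M), 1 / (N : ℝ) ^ k) +
          ∑ i : Fin M, (1 - r i) / (N : ℝ) ^ (K - 1 - (i : ℕ))) :=
  le_antisymm (sInf_le (PIRPSI.isAchievable_costFormula hN hM hr0 hr1 hr))
    (le_sInf fun _ hd => PIRPSI.ofReal_costFormula_le_of_isAchievable hN hK hM hr0 hd)
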